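/- For a closed simple polygon $P\subset\mathbb{R}^2$ (the closed region bounded by a simple closed polygonal curve), let $d_P(x,y)$ denote the geodesic distance in $P$, that is, the infimum of the lengths of the paths from $x$ to $y$ inside $P$. For $\alpha,\beta>0$, the polygon $P$ is called $(\alpha,\beta)$-covered if every point $p\in\partial P$ is a vertex of a triangle $T_p\subseteq P$ all of whose angles are at least $\alpha$ and all of whose sides have length at least $\beta\cdot\mathrm{diam}(P)$, where $\mathrm{diam}$ is the Euclidean diameter. For all $\alpha,\beta>0$ there are an integer $t\ge 0$ and a real number $M>0$, depending only on $\alpha$ and $\beta$, such that the following holds. Let $P$ be an $(\alpha,\beta)$-covered simple polygon, and let $S$ be a closed square (of positive side length, in arbitrary position and orientation) that intersects the interior of $P$. Then $S\cap P$ has finitely many connected components $C_1,\dots,C_m$, and there is a partition of the set $\{C_1,\dots,C_m\}$ into at most $t$ classes such that for every class $\mathcal{C}$, all $C_a,C_b\in\mathcal{C}$ (possibly $C_a=C_b$), and all points $x\in C_a$ and $y\in C_b$, we have $$d_P(x,y)\le M\cdot\mathrm{diam}(S).$$ -/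

import Mathlib

noncomputable section

namespace SquarePartition

/-- The Euclidean plane. -/
abbrev Plane : Type := EuclideanSpace ℝ (Fin 2)

/-- A polygon (a cyclic sequence of vertices) is simple if it has at least three vertices, these
are pairwise distinct, and two different edges meet only if they are consecutive, and then only
in the vertex they share. The edge `i` joins the vertices `i` and `i + 1` (cyclically). -/
structure IsSimple {n : ℕ} (Q : Polygon Plane n) : Prop where
  three_le : 3 ≤ n
  injective : Function.Injective Q.vertices
  edges : ∀ i j : Fin n, i ≠ j → ∀ x ∈ Q.edgeSet ℝ i ∩ Q.edgeSet ℝ j,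
    (j = finRotate n i ∧ x = Q j) ∨ (i = finRotate n j ∧ x = Q i)

/-- The closed region bounded by a polygonal closed curve: the curve together with the points
that it encloses, i.e. those in a bounded connected component of its complement. -/
def region {n : ℕ} (Q : Polygon Plane n) : Set Plane :=
  Q.boundary ℝ ∪ {x | x ∉ Q.boundary ℝ ∧
    Bornology.IsBounded (connectedComponentIn (Q.boundary ℝ)ᶜ x)}

/-- `P` is a (closed) simple polygon. -/
def IsSimplePolygon (P : Set Plane) : Prop :=
  ∃ (n : ℕ) (Q : Polygon Plane n), IsSimple Q ∧ P = region Q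

/-- A triangle is `α`-fat if each of its angles is at least `α`. -/
def IsFatTriangle (α : ℝ) (T : Affine.Triangle ℝ Plane) : Prop :=
  ∀ i j k : Fin 3, i ≠ j → j ≠ k → i ≠ k →
    α ≤ EuclideanGeometry.angle (T.points i) (T.points j) (T.points k)

/-- `P` is `(α, β)`-covered: each boundary point `p` is a vertex of an `α`-fat triangle
contained in `P` all of whose sides have length at least `β * diam P`. -/
def IsCovered (α β : ℝ) (P : Set Plane) : Prop :=
  ∀ p ∈ frontier P, ∃ T : Affine.Triangle ℝ Plane,
    (∃ i, T.points i = p) ∧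
    convexHull ℝ (Set.range T.points) ⊆ P ∧
    IsFatTriangle α T ∧
    ∀ i j : Fin 3, i ≠ j → β * Metric.diam P ≤ dist (T.points i) (T.points j)

/-- A closed, nondegenerate square, of arbitrary position and orientation: `c` is a corner,
`u` and `v` are the two sides at `c`. -/
def IsSquare (S : Set Plane) : Prop :=
  ∃ c u v : Plane, u ≠ 0 ∧ ‖u‖ = ‖v‖ ∧ inner ℝ u v = 0 ∧
    S = {x | ∃ s ∈ Set.Icc (0 : ℝ) 1, ∃ t ∈ Set.Icc (0 : ℝ) 1, x = c + s • u + t • v}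

/-- The geodesic distance in `P`: the infimum of the lengths of the paths from `x` to `y`
inside `P` (it is `⊤` if there is no path of finite length). -/
def gdist (P : Set Plane) (x y : Plane) : ENNReal :=
  ⨅ γ : {γ : Path x y // ∀ s, γ s ∈ P}, eVariationOn (γ.1 : unitInterval → Plane) Set.univ

/-- The set of the connected components of a subset `X` of the plane. -/
def components (X : Set Plane) : Set (Set Plane) :=
  {C | ∃ x ∈ X, C = connectedComponentIn X x}

end SquarePartition

end

noncomputable section

namespace SquarePartition

open Set unitInterval

/-! A fat triangle with vertex `p` contains a ball of radius proportional to `diam P`, and `p` sees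
all of it inside `P`. If two boundary points see the same ball of directions and are close together,
then homothetic copies of that ball shrunk towards them overlap, which joins the points by a short
two-segment path (`gdist_le_of_seesBall`). Finite nets for the direction and the position sort the
visible boundary points into boundedly many types. Every point of `S ∩ P` sees a boundary point
within `S ∩ P`, unless `S ⊆ P`. So `S ∩ P` is covered by boundedly many closed sets of small
geodesic diameter. A component is crossed by a chain of them, and components meeting a common one
form a class (`exists_partition_components`). Finiteness is separate: each component meets some edge
in the convex set `S ∩ edge`, or is `S` itself. -/

/-! ### Geodesic distance -/

lemma gdist_le_of_path {P : Set Plane} {x y : Plane} (γ : Path x y) (h : ∀ s, γ s ∈ P) :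
    gdist P x y ≤ eVariationOn γ univ :=
  iInf_le (fun γ : {γ : Path x y // ∀ s, γ s ∈ P} =>
    eVariationOn (γ.1 : unitInterval → Plane) univ) ⟨γ, h⟩

lemma gdist_comm_le (P : Set Plane) (x y : Plane) : gdist P x y ≤ gdist P y x := by
  refine le_iInf fun ⟨γ, h⟩ => (gdist_le_of_path γ.symm fun s => h _).trans ?_
  exact eVariationOn.comp_le_of_antitoneOn γ (s := univ) (t := univ) σ
    (fun a _ b _ hab => unitInterval.strictAnti_symm.antitone hab) (mapsTo_univ _ _)

lemma gdist_comm (P : Set Plane) (x y : Plane) : gdist P x y = gdist P y x :=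
  (gdist_comm_le P x y).antisymm (gdist_comm_le P y x)

lemma eVariationOn_trans_le {x y z : Plane} (γ : Path x y) (γ' : Path y z) :
    eVariationOn (γ.trans γ') univ ≤ eVariationOn γ univ + eVariationOn γ' univ := by
  let a : I := ⟨1 / 2, by norm_num, by norm_num⟩
  have hu : (univ : Set I) = Iic a ∪ Ici a := Iic_union_Ici.symm
  rw [hu, eVariationOn.union _ (x := a) isGreatest_Iic isLeast_Ici, ← hu]
  refine add_le_add ?_ ?_
  · have : EqOn (γ.trans γ') (γ ∘ fun t : I => projIcc 0 1 zero_le_one (2 * (t : ℝ))) (Iic a) := by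
      intro t ht
      have ht' : (t : ℝ) ≤ 1 / 2 := ht
      simp only [Path.trans, Path.coe_mk_mk, Function.comp, ht', if_true]
      rfl
    rw [eVariationOn.eq_of_eqOn this]
    refine eVariationOn.comp_le_of_monotoneOn _ _ (fun s _ t _ hst => ?_) (mapsTo_univ _ _)
    exact monotone_projIcc _ (by have : (s : ℝ) ≤ t := hst; linarith)
  · have : EqOn (γ.trans γ') (γ' ∘ fun t : I => projIcc 0 1 zero_le_one (2 * (t : ℝ) - 1))
        (Ici a) := by
      intro t ht
      have ht' : 1 / 2 ≤ (t : ℝ) := ht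
      rcases ht'.eq_or_lt with h | h
      · simp only [Path.trans, Path.coe_mk_mk, Function.comp, ← h]
        norm_num
      · simp only [Path.trans, Path.coe_mk_mk, Function.comp, not_le.2 h, if_false]
        rfl
    rw [eVariationOn.eq_of_eqOn this]
    refine eVariationOn.comp_le_of_monotoneOn _ _ (fun s _ t _ hst => ?_) (mapsTo_univ _ _)
    exact monotone_projIcc _ (by have : (s : ℝ) ≤ t := hst; linarith)

lemma gdist_triangle (P : Set Plane) (x y z : Plane) :
    gdist P x z ≤ gdist P x y + gdist P y z := by
  refine ENNReal.le_iInf_add_iInf fun γ γ' => ?_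
  refine (gdist_le_of_path (γ.1.trans γ'.1) fun s => ?_).trans (eVariationOn_trans_le _ _)
  have hs : γ.1.trans γ'.1 s ∈ range (γ.1.trans γ'.1) := mem_range_self s
  rw [Path.trans_range] at hs
  rcases hs with ⟨t, ht⟩ | ⟨t, ht⟩
  · exact ht ▸ γ.2 t
  · exact ht ▸ γ'.2 t

lemma gdist_le_of_segment {P : Set Plane} {x y : Plane} (h : segment ℝ x y ⊆ P) :
    gdist P x y ≤ ENNReal.ofReal (dist x y) := by
  let γ : Path x y :=
    { toFun := fun t => AffineMap.lineMap x y (t : ℝ)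
      continuous_toFun := by fun_prop
      source' := by simp
      target' := by simp }
  refine (gdist_le_of_path γ fun s => h ?_).trans ?_
  · rw [segment_eq_image_lineMap]
    exact ⟨s, s.2, rfl⟩
  have hl : LipschitzOnWith (nndist x y) (AffineMap.lineMap x y : ℝ → Plane) univ :=
    (lipschitzWith_lineMap x y).lipschitzOnWith
  have h1 := hl.comp_eVariationOn_le (g := ((↑) : I → ℝ)) (s := univ) (mapsTo_univ _ _)
  have h2 : eVariationOn ((↑) : I → ℝ) univ ≤ 1 := by
    have := MonotoneOn.eVariationOn_eq (f := ((↑) : I → ℝ)) (s := univ) (a := 0) (b := 1)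
      (fun s _ t _ hst => hst) trivial trivial
    have hI : (univ ∩ Icc 0 1 : Set I) = univ := by
      ext t; exact ⟨fun _ => trivial, fun _ => ⟨trivial, t.2.1, t.2.2⟩⟩
    rw [hI] at this
    simp [this]
  calc eVariationOn γ univ ≤ nndist x y * eVariationOn ((↑) : I → ℝ) univ := h1
    _ ≤ nndist x y * 1 := by gcongr
    _ = ENNReal.ofReal (dist x y) := by
      rw [mul_one, ← edist_nndist, edist_dist]

lemma gdist_le_trans {P : Set Plane} {x y z : Plane} {a b : ℝ} (ha : 0 ≤ a) (hb : 0 ≤ b)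
    (h1 : gdist P x y ≤ ENNReal.ofReal a) (h2 : gdist P y z ≤ ENNReal.ofReal b) :
    gdist P x z ≤ ENNReal.ofReal (a + b) := by
  rw [ENNReal.ofReal_add ha hb]
  exact (gdist_triangle P x y z).trans (add_le_add h1 h2)

/-! ### Balls inside fat triangles -/

/-- The determinant of two vectors of the plane. -/
def cross (a b : Plane) : ℝ := a 0 * b 1 - a 1 * b 0

lemma cross_sq (a b : Plane) : cross a b ^ 2 = ‖a‖ ^ 2 * ‖b‖ ^ 2 - inner ℝ a b ^ 2 := by
  simp only [cross, EuclideanSpace.real_norm_sq_eq, PiLp.inner_apply, Fin.sum_univ_two,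
    RCLike.inner_apply, conj_trivial]
  ring

lemma abs_cross_le (a b : Plane) : |cross a b| ≤ ‖a‖ * ‖b‖ := by
  apply abs_le_of_sq_le_sq _ (by positivity)
  rw [cross_sq, mul_pow]
  nlinarith [sq_nonneg (inner ℝ a b)]

lemma abs_cross_eq (a b : Plane) :
    |cross a b| = Real.sin (InnerProductGeometry.angle a b) * (‖a‖ * ‖b‖) := by
  rw [InnerProductGeometry.sin_angle_mul_norm_mul_norm, ← Real.sqrt_sq_eq_abs, cross_sq,
    real_inner_self_eq_norm_sq, real_inner_self_eq_norm_sq, sq (inner ℝ a b)]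

lemma cross_smul_eq (a b u : Plane) :
    cross a b • u = cross u b • a + cross a u • b := by
  ext i
  fin_cases i <;> simp [cross] <;> ring

/-- By Cramer's rule (`cross_smul_eq`), moving by at most `r` from the centroid changes the
coordinates along `a` and `b` by at most 1/6 each, so all three barycentric coordinates, 1/3 at the
centroid, stay nonnegative. -/
lemma closedBall_subset_of_convex {K : Set Plane} (hK : Convex ℝ K) {p a b : Plane}
    (hp : p ∈ K) (ha : p + a ∈ K) (hb : p + b ∈ K) {d r : ℝ} (hd : ‖a‖ ≤ d) (hd' : ‖b‖ ≤ d)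
    (hc : 0 < |cross a b|) (hr : 6 * (r * d) ≤ |cross a b|) :
    Metric.closedBall (p + (1 / 3 : ℝ) • (a + b)) r ⊆ K := by
  intro w hw
  rw [mem_closedBall_iff_norm] at hw
  set u := w - (p + (1 / 3 : ℝ) • (a + b)) with hu
  have hr0 : 0 ≤ r := (norm_nonneg _).trans hw
  have hc0 : cross a b ≠ 0 := abs_pos.1 hc
  set s := cross u b / cross a b with hs
  set t := cross a u / cross a b with ht
  have hs' : |s| ≤ 1 / 6 := by
    rw [hs, abs_div, div_le_iff₀ hc]
    have : ‖u‖ * ‖b‖ ≤ r * d := mul_le_mul hw hd' (norm_nonneg _) hr0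
    linarith [abs_cross_le u b]
  have ht' : |t| ≤ 1 / 6 := by
    rw [ht, abs_div, div_le_iff₀ hc]
    have : ‖u‖ * ‖a‖ ≤ r * d := mul_le_mul hw hd (norm_nonneg _) hr0
    linarith [abs_cross_le a u]
  have huv : u = s • a + t • b := by
    rw [hs, ht, div_eq_inv_mul, div_eq_inv_mul, mul_smul, mul_smul, ← smul_add, ← cross_smul_eq,
      inv_smul_smul₀ hc0]
  rw [abs_le] at hs' ht'
  have hmem := hK.sum_mem (t := Finset.univ) (w := ![1 / 3 - s - t, 1 / 3 + s, 1 / 3 + t])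
    (z := ![p, p + a, p + b])
    (by intro i _; fin_cases i <;> simp <;> linarith)
    (by simp [Fin.sum_univ_three]; ring)
    (by intro i _; fin_cases i <;> simpa)
  convert hmem using 1
  have hw' : w = p + (1 / 3 : ℝ) • (a + b) + (s • a + t • b) := by rw [← huv, hu]; abel
  rw [hw']
  simp only [Fin.sum_univ_three, Matrix.cons_val]
  module

/-- The cap at `π / 2` keeps the bound where sine increases. For an obtuse angle, its supplement is
the sum of the other two angles, hence at least `α`. -/
lemma sin_le_sin_angle {α : ℝ} (hα : 0 < α) {T : Affine.Triangle ℝ Plane}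
    (hT : IsFatTriangle α T) {i j k : Fin 3} (hij : i ≠ j) (hjk : j ≠ k) (hik : i ≠ k) :
    Real.sin (min α (Real.pi / 2)) ≤
      Real.sin (EuclideanGeometry.angle (T.points i) (T.points j) (T.points k)) := by
  have h1 := hT i j k hij hjk hik
  have h2 := hT j k i hjk hik.symm hij.symm
  have h3 := hT k i j hik.symm hij hjk.symm
  have hsum := EuclideanGeometry.angle_add_angle_add_angle_eq_pi (T.points k)
    (T.independent.injective.ne hij.symm)
  set θ := EuclideanGeometry.angle (T.points i) (T.points j) (T.points k)
  have hα' : 0 < min α (Real.pi / 2) := lt_min hα (by positivity)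
  have hm := min_le_left α (Real.pi / 2)
  have hm' := min_le_right α (Real.pi / 2)
  rcases le_total θ (Real.pi / 2) with h | h
  · exact Real.sin_le_sin_of_le_of_le_pi_div_two (by linarith) h (hm.trans h1)
  · rw [← Real.sin_pi_sub θ]
    exact Real.sin_le_sin_of_le_of_le_pi_div_two (by linarith) (by linarith) (by linarith)

/-! ### Boundary points that see a common ball -/

/-- The points from which the ball of radius `r` around the translate by `v` is visible in `P`. -/
def seesBall (P : Set Plane) (v : Plane) (r : ℝ) : Set Plane :=
  {p | ∀ w ∈ Metric.closedBall v r, ∀ t ∈ Icc (0 : ℝ) 1, p + t • w ∈ P}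

lemma isClosed_seesBall {P : Set Plane} (hP : IsClosed P) (v : Plane) (r : ℝ) :
    IsClosed (seesBall P v r) := by
  have : seesBall P v r = ⋂ w ∈ Metric.closedBall v r, ⋂ t ∈ Icc (0 : ℝ) 1,
      (fun p => p + t • w) ⁻¹' P := by
    ext p; simp only [seesBall, mem_iInter₂, mem_ofPred_eq, mem_preimage]
  rw [this]
  exact isClosed_biInter fun w _ => isClosed_biInter fun t _ => hP.preimage (by fun_prop)

lemma seesBall_mono {P : Set Plane} {v v' : Plane} {r r' : ℝ}
    (h : Metric.closedBall v' r' ⊆ Metric.closedBall v r) : seesBall P v r ⊆ seesBall P v' r' :=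
  fun _ hp w hw => hp w (h hw)

lemma segment_subset_of_seesBall {P : Set Plane} {v w p : Plane} {r l : ℝ}
    (hp : p ∈ seesBall P v r) (hw : w ∈ Metric.closedBall v r) (hl : l ∈ Icc (0 : ℝ) 1) :
    segment ℝ p (p + l • w) ⊆ P := by
  rw [segment_eq_image']
  rintro _ ⟨t, ht, rfl⟩
  have := hp w hw (t * l) ⟨mul_nonneg ht.1 hl.1, mul_le_one₀ ht.2 hl.1 hl.2⟩
  simpa [mul_smul] using this

lemma gdist_le_of_seesBall {P : Set Plane} {v p q : Plane} {r l : ℝ}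
    (hp : p ∈ seesBall P v r) (hq : q ∈ seesBall P v r) (hr : 0 ≤ r) (hl : 0 < l) (hl' : l ≤ 1)
    (hpq : dist p q ≤ l * r) :
    gdist P p q ≤ ENNReal.ofReal (l * (2 * ‖v‖ + r)) := by
  have hl1 : l ∈ Icc (0 : ℝ) 1 := ⟨hl.le, hl'⟩
  -- Chosen so that `q + l • w = p + l • v`; the bound on `dist p q` keeps `w` in the ball seen from
  -- `q`.
  set w := v + l⁻¹ • (p - q) with hw
  have hwv : ‖w - v‖ ≤ r := by
    rw [hw, add_sub_cancel_left, norm_smul, norm_inv, Real.norm_of_nonneg hl.le,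
      inv_mul_le_iff₀ hl, ← dist_eq_norm]
    exact hpq
  have h1 : gdist P p (p + l • v) ≤ ENNReal.ofReal (l * ‖v‖) := by
    refine (gdist_le_of_segment (segment_subset_of_seesBall hp (Metric.mem_closedBall_self hr)
      hl1)).trans (ENNReal.ofReal_le_ofReal ?_)
    rw [dist_self_add_right, norm_smul, Real.norm_of_nonneg hl.le]
  have h2 : gdist P q (q + l • w) ≤ ENNReal.ofReal (l * (‖v‖ + r)) := by
    refine (gdist_le_of_segment (segment_subset_of_seesBall hq (mem_closedBall_iff_norm.2 hwv)
      hl1)).trans (ENNReal.ofReal_le_ofReal ?_)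
    rw [dist_self_add_right, norm_smul, Real.norm_of_nonneg hl.le]
    have := norm_add_le v (w - v)
    rw [add_sub_cancel] at this
    exact mul_le_mul_of_nonneg_left (by linarith) hl.le
  have h3 : q + l • w = p + l • v := by
    rw [hw, smul_add, smul_inv_smul₀ hl.ne']; abel
  rw [h3, gdist_comm] at h2
  refine (gdist_le_trans (by positivity) (by positivity) h1 h2).trans_eq ?_
  congr 1; ring

/-- The relative size of the balls seen from the boundary points of an `(α, β)`-covered set. -/
def ballRatio (α β : ℝ) : ℝ := β ^ 2 * Real.sin (min α (Real.pi / 2)) / 6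

lemma ballRatio_pos {α β : ℝ} (hα : 0 < α) (hβ : 0 < β) : 0 < ballRatio α β := by
  have : 0 < Real.sin (min α (Real.pi / 2)) :=
    Real.sin_pos_of_pos_of_lt_pi (lt_min hα (by positivity))
      ((min_le_right _ _).trans_lt (by linarith [Real.pi_pos]))
  unfold ballRatio; positivity

lemma IsCovered.exists_mem_seesBall {α β : ℝ} (hα : 0 < α) (hβ : 0 < β) {P : Set Plane}
    (hP : IsCovered α β P) (hb : Bornology.IsBounded P) (hd : 0 < Metric.diam P) {p : Plane}
    (hp : p ∈ frontier P) :
    ∃ v : Plane, ‖v‖ ≤ Metric.diam P ∧ p ∈ seesBall P v (ballRatio α β * Metric.diam P) := by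
  obtain ⟨T, ⟨j, rfl⟩, hTP, hfat, hside⟩ := hP p hp
  obtain ⟨i, k, hij, hjk, hik⟩ : ∃ i k : Fin 3, i ≠ j ∧ j ≠ k ∧ i ≠ k :=
    (by decide : ∀ j : Fin 3, ∃ i k : Fin 3, i ≠ j ∧ j ≠ k ∧ i ≠ k) j
  have hsub := subset_convexHull ℝ (range T.points)
  have hmem : ∀ i, T.points i ∈ convexHull ℝ (range T.points) := fun i => hsub (mem_range_self i)
  set d := Metric.diam P
  set a := T.points i - T.points j with ha
  set b := T.points k - T.points j with hb'
  have had : ‖a‖ ≤ d := by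
    rw [ha, ← dist_eq_norm]; exact Metric.dist_le_diam_of_mem hb (hTP (hmem i)) (hTP (hmem j))
  have hbd : ‖b‖ ≤ d := by
    rw [hb', ← dist_eq_norm]; exact Metric.dist_le_diam_of_mem hb (hTP (hmem k)) (hTP (hmem j))
  have ha1 : β * d ≤ ‖a‖ := by rw [ha, ← dist_eq_norm]; exact hside i j hij
  have hb1 : β * d ≤ ‖b‖ := by rw [hb', ← dist_eq_norm]; exact hside k j hjk.symm
  -- The determinant is `sin θ * ‖a‖ * ‖b‖`, with both sides at least `β * d`; `ballRatio` is
  -- calibrated to this and to the factor 6 of `closedBall_subset_of_convex`.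
  have hcr : 6 * (ballRatio α β * d * d) ≤ |cross a b| := by
    have hs := sin_le_sin_angle hα hfat hij hjk hik
    have hab : (β * d) * (β * d) ≤ ‖a‖ * ‖b‖ :=
      mul_le_mul ha1 hb1 (by positivity) (norm_nonneg _)
    have hs0 : 0 ≤ Real.sin (min α (Real.pi / 2)) := by
      have := ballRatio_pos hα hβ
      unfold ballRatio at this
      by_contra! h
      nlinarith [sq_nonneg β]
    rw [abs_cross_eq]
    calc 6 * (ballRatio α β * d * d)
        = Real.sin (min α (Real.pi / 2)) * ((β * d) * (β * d)) := by unfold ballRatio; ring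
      _ ≤ _ := mul_le_mul hs hab (by positivity) (hs0.trans hs)
  have hr := ballRatio_pos hα hβ
  have hball := closedBall_subset_of_convex (convex_convexHull ℝ (range T.points)) (hmem j)
    (a := a) (b := b) (by simpa [ha] using hmem i) (by simpa [hb'] using hmem k) had hbd
    (lt_of_lt_of_le (by positivity) hcr) hcr
  refine ⟨(1 / 3 : ℝ) • (a + b), ?_, fun w hw t ht => hTP ?_⟩
  · rw [norm_smul, Real.norm_of_nonneg (by norm_num)]
    linarith [norm_add_le a b]
  · have hw' : T.points j + w ∈ convexHull ℝ (range T.points) := by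
      apply hball
      rw [mem_closedBall_iff_norm] at hw ⊢
      rwa [add_sub_add_left_eq_sub]
    exact (convex_convexHull ℝ _).add_smul_mem (hmem j) hw' ht

/-! ### Topology of the polygonal region -/

section Region
variable {n : ℕ} (Q : Polygon Plane n)

lemma edgeSet_eq_segment (i : Fin n) :
    Q.edgeSet ℝ i = segment ℝ (Q i) (Q (finRotate n i)) :=
  (segment_eq_image_lineMap ℝ _ _).symm

lemma isCompact_boundary : IsCompact (Q.boundary ℝ) :=
  isCompact_iUnion fun i => by
    rw [edgeSet_eq_segment, segment_eq_image_lineMap]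
    exact isCompact_Icc.image (by fun_prop)

lemma boundary_subset_region : Q.boundary ℝ ⊆ region Q := subset_union_left

lemma isOpen_region_diff : IsOpen {x | x ∉ Q.boundary ℝ ∧
    Bornology.IsBounded (connectedComponentIn (Q.boundary ℝ)ᶜ x)} := by
  rw [isOpen_iff_mem_nhds]
  rintro x ⟨hx, hb⟩
  filter_upwards [((isCompact_boundary Q).isClosed.isOpen_compl.connectedComponentIn
    (x := x)).mem_nhds (mem_connectedComponentIn hx)] with y hy
  exact ⟨connectedComponentIn_subset _ _ hy, (connectedComponentIn_eq hy) ▸ hb⟩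

lemma isClosed_region : IsClosed (region Q) := by
  rw [← isOpen_compl_iff, isOpen_iff_mem_nhds]
  intro x hx
  have hxb : x ∉ Q.boundary ℝ := fun h => hx (Or.inl h)
  filter_upwards [((isCompact_boundary Q).isClosed.isOpen_compl.connectedComponentIn
    (x := x)).mem_nhds (mem_connectedComponentIn hxb)] with y hy hyr
  rcases hyr with h | h
  · exact connectedComponentIn_subset _ _ hy h
  · exact hx (Or.inr ⟨hxb, (connectedComponentIn_eq hy).symm ▸ h.2⟩)

lemma frontier_region_subset : frontier (region Q) ⊆ Q.boundary ℝ := by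
  rw [(isClosed_region Q).frontier_eq]
  rintro x ⟨hx, hxi⟩
  rcases hx with h | h
  · exact h
  · exact (hxi (interior_maximal subset_union_right (isOpen_region_diff Q) h)).elim

lemma isBounded_region : Bornology.IsBounded (region Q) := by
  obtain ⟨R, hR⟩ := (isCompact_boundary Q).isBounded.subset_closedBall 0
  refine (Metric.isBounded_closedBall (x := (0 : Plane)) (r := max R 0)).subset ?_
  rintro x (hx | ⟨hx, hb⟩)
  · exact Metric.closedBall_subset_closedBall (le_max_left _ _) (hR hx)
  by_contra hxR
  rw [mem_closedBall_zero_iff, not_le, max_lt_iff] at hxR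
  -- The ray from `x` away from the origin misses a ball containing the curve, so the component of
  -- `x` is unbounded.
  have hray : (fun t : ℝ => t • x) '' Ici 1 ⊆ connectedComponentIn (Q.boundary ℝ)ᶜ x := by
    refine IsPreconnected.subset_connectedComponentIn
      (isPreconnected_Ici.image _ (by fun_prop)) ⟨1, self_mem_Ici, one_smul _ _⟩ ?_
    rintro _ ⟨t, ht, rfl⟩ hmem
    have := hR hmem
    rw [mem_closedBall_zero_iff, norm_smul, Real.norm_of_nonneg (zero_le_one.trans ht)] at this
    have ht1 : 1 ≤ t := ht
    nlinarith
  obtain ⟨C, hC⟩ := (hb.subset hray).exists_norm_le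
  have := hC _ ⟨max 1 ((C + 1) / ‖x‖), mem_Ici.2 (le_max_left _ _), rfl⟩
  rw [norm_smul, Real.norm_of_nonneg (zero_le_one.trans (le_max_left _ _))] at this
  have h2 : (C + 1) / ‖x‖ * ‖x‖ ≤ max 1 ((C + 1) / ‖x‖) * ‖x‖ :=
    mul_le_mul_of_nonneg_right (le_max_right _ _) (norm_nonneg _)
  rw [div_mul_cancel₀ _ hxR.2.ne'] at h2
  linarith

end Region

lemma IsSquare.isCompact {S : Set Plane} (h : IsSquare S) : IsCompact S := by
  obtain ⟨c, u, v, -, -, -, rfl⟩ := h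
  convert (isCompact_Icc (a := (0 : ℝ)) (b := 1)).prod (isCompact_Icc (a := (0 : ℝ)) (b := 1))
    |>.image (f := fun z : ℝ × ℝ => c + z.1 • u + z.2 • v) (by fun_prop) using 1
  ext x
  simp only [mem_ofPred_eq, mem_image, mem_prod, Prod.exists]
  grind

lemma IsSquare.convex {S : Set Plane} (h : IsSquare S) : Convex ℝ S := by
  obtain ⟨c, u, v, -, -, -, rfl⟩ := h
  rintro _ ⟨s, hs, t, ht, rfl⟩ _ ⟨s', hs', t', ht', rfl⟩ a b ha hb hab
  refine ⟨a * s + b * s', convex_Icc (0 : ℝ) 1 hs hs' ha hb hab,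
    a * t + b * t', convex_Icc (0 : ℝ) 1 ht ht' ha hb hab, ?_⟩
  have : c = a • c + b • c := by rw [← add_smul, hab, one_smul]
  conv_rhs => rw [this]
  module

/-! ### First boundary point on a segment -/

lemma inter_frontier_nonempty {P t : Set Plane} (hP : IsClosed P) (ht : IsPreconnected t)
    (h : (t ∩ P).Nonempty) (h' : (t ∩ Pᶜ).Nonempty) : (t ∩ frontier P).Nonempty := by
  by_contra hn
  have hint : ∀ z ∈ t, z ∈ P → z ∈ interior P := by
    intro z hz hzP
    by_contra hi
    exact hn ⟨z, hz, hP.frontier_eq ▸ ⟨hzP, hi⟩⟩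
  obtain ⟨x, hx, hxP⟩ := h
  obtain ⟨z, -, hz, hz'⟩ := ht (interior P) Pᶜ isOpen_interior hP.isOpen_compl
    (fun z hz => (em (z ∈ P)).imp (hint z hz) id) ⟨x, hx, hint x hx hxP⟩ h'
  exact hz' (interior_subset hz)

lemma exists_frontier_of_segment {P : Set Plane} {x y : Plane} (hx : x ∈ P) (hy : y ∈ frontier P)
    (hP : IsClosed P) :
    ∃ p ∈ frontier P, p ∈ segment ℝ x y ∧ segment ℝ x p ⊆ P := by
  let f : ℝ → Plane := AffineMap.lineMap x y
  have hf : Continuous f := AffineMap.lineMap_continuous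
  have hK : IsCompact (Icc (0 : ℝ) 1 ∩ f ⁻¹' frontier P) :=
    isCompact_Icc.inter_right (isClosed_frontier.preimage hf)
  obtain ⟨t, ⟨ht, htP⟩, hmin⟩ := hK.exists_isLeast ⟨1, by simp, by simpa [f] using hy⟩
  refine ⟨f t, htP, ?_, ?_⟩
  · rw [segment_eq_image_lineMap]; exact ⟨t, ht, rfl⟩
  have himg : segment ℝ x (f t) = f '' Icc 0 t := by
    have h0 : x = f 0 := by simp [f]
    conv_lhs => rw [h0]
    have := image_segment ℝ (AffineMap.lineMap x y : ℝ →ᵃ[ℝ] Plane) 0 t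
    rw [segment_eq_Icc ht.1] at this
    exact this.symm
  rw [himg]
  rintro _ ⟨s, hs, rfl⟩
  by_contra hsP
  obtain ⟨_, ⟨r, hr, rfl⟩, hrP⟩ := inter_frontier_nonempty hP
    ((isPreconnected_Icc (a := (0 : ℝ)) (b := s)).image f hf.continuousOn) ⟨x, ⟨0, ⟨le_rfl, hs.1⟩, by simp [f]⟩, hx⟩ ⟨f s, ⟨s, ⟨hs.1, le_rfl⟩, rfl⟩, hsP⟩
  have h1 : t ≤ r := hmin ⟨⟨hr.1, hr.2.trans (hs.2.trans ht.2)⟩, hrP⟩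
  have : s = t := le_antisymm hs.2 (h1.trans hr.2)
  exact hsP (this ▸ hP.frontier_subset htP)

/-! ### Chains of closed sets and the partition of components -/

lemma gdist_le_of_walk {P : Set Plane} {ι : Type*} {G : SimpleGraph ι} {B : ι → Set Plane} {L : ℝ}
    (hL : 0 ≤ L) (hB : ∀ i, ∀ x ∈ B i, ∀ y ∈ B i, gdist P x y ≤ ENNReal.ofReal L)
    (hG : ∀ i j, G.Adj i j → (B i ∩ B j).Nonempty) {i j : ι} (w : G.Walk i j) :
    ∀ x ∈ B i, ∀ y ∈ B j, gdist P x y ≤ ENNReal.ofReal ((w.length + 1) * L) := by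
  induction w with
  | nil => intro x hx y hy; simpa using hB _ x hx y hy
  | cons h w ih =>
    intro x hx y hy
    obtain ⟨z, hz, hz'⟩ := hG _ _ h
    refine (gdist_le_trans hL (by positivity) (hB _ x hx z hz) (ih z hz' y hy)).trans_eq ?_
    congr 1
    push_cast [SimpleGraph.Walk.length_cons]
    ring

/-- The intersection graph of the pieces is connected along `C`, since otherwise two finite unions
of closed sets would separate `C`. A simple path in it uses each piece at most once. -/
lemma gdist_le_of_closed_cover {P C : Set Plane} {ι : Type*} [Fintype ι] {B : ι → Set Plane} {L : ℝ}
    (hL : 0 ≤ L) (hB : ∀ i, ∀ x ∈ B i, ∀ y ∈ B i, gdist P x y ≤ ENNReal.ofReal L)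
    (hcl : ∀ i, IsClosed (B i)) (hC : IsPreconnected C) (hcov : C ⊆ ⋃ i, B i) :
    ∀ x ∈ C, ∀ y ∈ C, gdist P x y ≤ ENNReal.ofReal (Fintype.card ι * L) := by
  classical
  intro x hx y hy
  obtain ⟨i, hi⟩ := mem_iUnion.1 (hcov hx)
  obtain ⟨j, hj⟩ := mem_iUnion.1 (hcov hy)
  let G : SimpleGraph ι := SimpleGraph.fromRel fun i j => (B i ∩ B j).Nonempty
  have hG : ∀ i j, G.Adj i j → (B i ∩ B j).Nonempty := by
    intro i j h
    rcases h.2 with h | h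
    · exact h
    · rwa [inter_comm]
  have hreach : G.Reachable i j := by
    by_contra hn
    obtain ⟨z, -, hz1, hz2⟩ := isPreconnected_closed_iff.1 hC
      (⋃ k ∈ {k | G.Reachable i k}, B k) (⋃ k ∈ {k | ¬ G.Reachable i k}, B k)
      ((toFinite _).isClosed_biUnion fun k _ => hcl k)
      ((toFinite _).isClosed_biUnion fun k _ => hcl k)
      (fun z hz => by
        obtain ⟨k, hk⟩ := mem_iUnion.1 (hcov hz)
        by_cases h : G.Reachable i k
        · exact Or.inl (mem_biUnion h hk)
        · exact Or.inr (mem_biUnion h hk))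
      ⟨x, hx, mem_biUnion (SimpleGraph.Reachable.refl i) hi⟩
      ⟨y, hy, mem_biUnion hn hj⟩
    simp only [mem_iUnion, mem_ofPred_eq] at hz1 hz2
    obtain ⟨k, hk, hzk⟩ := hz1
    obtain ⟨l, hl, hzl⟩ := hz2
    have hkl : k ≠ l := fun h => hl (h ▸ hk)
    exact hl (hk.trans (SimpleGraph.Adj.reachable ⟨hkl, Or.inl ⟨z, hzk, hzl⟩⟩))
  obtain ⟨w, hw⟩ := hreach.exists_isPath
  refine (gdist_le_of_walk hL hB hG w x hi y hj).trans (ENNReal.ofReal_le_ofReal ?_)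
  have : ((w.length + 1 : ℕ) : ℝ) ≤ Fintype.card ι := Nat.cast_le.2 hw.length_lt
  push_cast at this
  exact mul_le_mul_of_nonneg_right this hL

/-- The set is the projection of a compact set of pairs `(x, p)`. -/
lemma isClosed_setOf_segment_subset {X A : Set Plane} (hX : IsCompact X) (hA : IsClosed A) :
    IsClosed {x | ∃ p ∈ A, segment ℝ x p ⊆ X} := by
  have hZ : IsClosed {z : Plane × Plane | z.2 ∈ A ∧ segment ℝ z.1 z.2 ⊆ X} := by
    have : {z : Plane × Plane | z.2 ∈ A ∧ segment ℝ z.1 z.2 ⊆ X} = Prod.snd ⁻¹' A ∩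
        ⋂ t ∈ Icc (0 : ℝ) 1, (fun z : Plane × Plane => z.1 + t • (z.2 - z.1)) ⁻¹' X := by
      ext z
      simp only [segment_eq_image', mem_ofPred_eq, mem_inter_iff, mem_preimage, mem_iInter₂,
        subset_def, forall_mem_image]
    rw [this]
    exact (hA.preimage continuous_snd).inter
      (isClosed_biInter fun t _ => hX.isClosed.preimage (by fun_prop))
  have hK : IsCompact {z : Plane × Plane | z.2 ∈ A ∧ segment ℝ z.1 z.2 ⊆ X} :=
    (hX.prod hX).of_isClosed_subset hZ fun z hz =>
      ⟨hz.2 (left_mem_segment _ _ _), hz.2 (right_mem_segment _ _ _)⟩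
  convert (hK.image continuous_fst).isClosed using 1
  ext x
  simp

/-- The partition of a set into the nonempty fibres of a map. -/
def fiberPartition {κ ι : Type*} (K : Set κ) (f : κ → ι) : Partition K where
  parts := {c | c.Nonempty ∧ ∃ i, c = K ∩ f ⁻¹' {i}}
  sSupIndep' := by
    rintro _ ⟨-, i, rfl⟩
    rw [disjoint_sSup_iff]
    rintro _ ⟨⟨-, j, rfl⟩, hne⟩
    rw [Set.disjoint_left]
    rintro x ⟨hx, hi⟩ ⟨-, hj⟩
    have hi' : f x = i := hi
    have hj' : f x = j := hj
    exact hne (by rw [mem_singleton_iff, ← hi', ← hj'])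
  bot_notMem' := fun h => h.1.ne_empty rfl
  sSup_eq' := by
    apply subset_antisymm
    · rintro x ⟨_, ⟨-, i, rfl⟩, hx⟩
      exact hx.1
    · intro x hx
      exact ⟨K ∩ f ⁻¹' {f x}, ⟨⟨x, hx, rfl⟩, f x, rfl⟩, hx, rfl⟩

lemma encard_fiberPartition_le {κ ι : Type*} [Fintype ι] (K : Set κ) (f : κ → ι) :
    (fiberPartition K f).parts.encard ≤ Fintype.card ι := by
  have h : (fiberPartition K f).parts ⊆ (fun i => K ∩ f ⁻¹' {i}) '' univ := by
    rintro _ ⟨-, i, rfl⟩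
    exact ⟨i, trivial, rfl⟩
  refine (encard_le_encard h).trans ((encard_image_le _ _).trans ?_)
  simp

theorem exists_partition_components {P X : Set Plane} {ι : Type*} [Fintype ι] {A : ι → Set Plane}
    {D L : ℝ} (hne : X.Nonempty) (hX : IsCompact X) (hXP : X ⊆ P) (hA : ∀ i, IsClosed (A i)) (hD : 0 ≤ D) (hL : 0 ≤ L)
    (hXD : ∀ x ∈ X, ∀ y ∈ X, dist x y ≤ D)
    (hAL : ∀ i, ∀ p ∈ A i ∩ X, ∀ q ∈ A i ∩ X, gdist P p q ≤ ENNReal.ofReal L)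
    (hsee : ∀ x ∈ X, ∃ i, ∃ p ∈ A i, segment ℝ x p ⊆ X) :
    ∃ 𝒦 : Partition (components X), 𝒦.parts.encard ≤ Fintype.card ι ∧
      ∀ 𝒞 ∈ 𝒦, ∀ C₁ ∈ 𝒞, ∀ C₂ ∈ 𝒞, ∀ x ∈ C₁, ∀ y ∈ C₂,
        gdist P x y ≤ ENNReal.ofReal ((2 * Fintype.card ι + 1) * (2 * D + L)) := by
  let B : ι → Set Plane := fun i => {x | ∃ p ∈ A i, segment ℝ x p ⊆ X}
  have hBcl : ∀ i, IsClosed (B i) := fun i => isClosed_setOf_segment_subset hX (hA i)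
  have hBL : ∀ i, ∀ x ∈ B i, ∀ y ∈ B i, gdist P x y ≤ ENNReal.ofReal (2 * D + L) := by
    rintro i x ⟨p, hp, hxp⟩ y ⟨q, hq, hyq⟩
    have key : ∀ {x p}, segment ℝ x p ⊆ X → gdist P x p ≤ ENNReal.ofReal D := fun h =>
      (gdist_le_of_segment (h.trans hXP)).trans (ENNReal.ofReal_le_ofReal
        (hXD _ (h (left_mem_segment _ _ _)) _ (h (right_mem_segment _ _ _))))
    have h1 := key hxp
    have h2 := hAL i p ⟨hp, hxp (right_mem_segment _ _ _)⟩ q ⟨hq, hyq (right_mem_segment _ _ _)⟩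
    have h3 := key hyq
    rw [gdist_comm] at h3
    refine (gdist_le_trans (by positivity) hD (gdist_le_trans hD hL h1 h2) h3).trans_eq ?_
    congr 1; ring
  have hcov : X ⊆ ⋃ i, B i := fun x hx => mem_iUnion.2 (hsee x hx)
  -- Each component is labelled by one piece that it meets; the classes are the fibres of the label.
  -- The label of a non-component is arbitrary.
  have hidx : ∀ C : Set Plane, ∃ i, C ∈ components X → (C ∩ B i).Nonempty := by
    intro C
    by_cases hC : C ∈ components X
    · obtain ⟨x, hx, rfl⟩ := hC
      obtain ⟨i, hi⟩ := mem_iUnion.1 (hcov hx)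
      exact ⟨i, fun _ => ⟨x, mem_connectedComponentIn hx, hi⟩⟩
    · exact ⟨(hsee _ hne.some_mem).choose, fun h => (hC h).elim⟩
  choose f hf using hidx
  have hcomp : ∀ C ∈ components X, ∀ x ∈ C, ∀ y ∈ C,
      gdist P x y ≤ ENNReal.ofReal (Fintype.card ι * (2 * D + L)) := by
    rintro _ ⟨z, -, rfl⟩
    exact gdist_le_of_closed_cover (by positivity) hBL hBcl isPreconnected_connectedComponentIn
      ((connectedComponentIn_subset _ _).trans hcov)
  refine ⟨fiberPartition _ f, encard_fiberPartition_le _ _, ?_⟩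
  rintro _ ⟨-, i, rfl⟩ C₁ ⟨hC₁, h₁⟩ C₂ ⟨hC₂, h₂⟩ x hx y hy
  obtain ⟨z₁, hz₁, hz₁'⟩ := hf C₁ hC₁
  obtain ⟨z₂, hz₂, hz₂'⟩ := hf C₂ hC₂
  have e₁ : f C₁ = i := h₁
  have e₂ : f C₂ = i := h₂
  rw [e₁] at hz₁'
  rw [e₂] at hz₂'
  -- Cross the first component, the common piece, then the second component: this gives `2 * card +
  -- 1`.
  refine (gdist_le_trans (by positivity) (by positivity) (gdist_le_trans (by positivity)
    (by positivity) (hcomp C₁ hC₁ x hx z₁ hz₁) (hBL i z₁ hz₁' z₂ hz₂'))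
    (hcomp C₂ hC₂ z₂ hz₂ y hy)).trans_eq ?_
  congr 1; ring

theorem finite_components {X : Set Plane} {ι : Type*} [Finite ι] {E : ι → Set Plane}
    (hE : ∀ i, IsPreconnected (E i)) (hEX : ∀ i, E i ⊆ X)
    (hsee : ∀ x ∈ X, ∃ i, ∃ p ∈ E i, segment ℝ x p ⊆ X) : (components X).Finite := by
  have : components X ⊆ ⋃ i, {C | ∃ x ∈ E i, C = connectedComponentIn X x} := by
    rintro _ ⟨x, hx, rfl⟩
    obtain ⟨i, p, hp, hxp⟩ := hsee x hx
    refine mem_iUnion.2 ⟨i, p, hp, connectedComponentIn_eq ?_⟩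
    exact (convex_segment x p).isPreconnected.subset_connectedComponentIn
      (left_mem_segment _ _ _) hxp (right_mem_segment _ _ _)
  refine (finite_iUnion fun i => Set.Subsingleton.finite ?_).subset this
  rintro _ ⟨x, hx, rfl⟩ _ ⟨y, hy, rfl⟩
  exact connectedComponentIn_eq ((hE i).subset_connectedComponentIn hx (hEX i) hy)

lemma IsSquare.diam_pos {S : Set Plane} (h : IsSquare S) : 0 < Metric.diam S := by
  have hb := h.isCompact.isBounded
  obtain ⟨c, u, v, hu, -, -, rfl⟩ := h
  refine Metric.diam_pos ⟨c, ⟨0, by simp, 0, by simp, by simp⟩, c + u,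
    ⟨1, by simp, 0, by simp, by simp⟩, ?_⟩ hb
  simpa using hu

lemma exists_visible_frontier {P S : Set Plane} (hP : IsClosed P) (hS : Convex ℝ S) {x : Plane}
    (hx : x ∈ S ∩ P) (hSP : ¬ S ⊆ P) :
    ∃ p ∈ frontier P, segment ℝ x p ⊆ S ∩ P := by
  obtain ⟨z, hz, hzP⟩ := not_subset.1 hSP
  obtain ⟨y, hyS, hy⟩ := inter_frontier_nonempty hP hS.isPreconnected ⟨x, hx⟩ ⟨z, hz, hzP⟩
  obtain ⟨p, hp, hpxy, hseg⟩ := exists_frontier_of_segment hx.2 hy hP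
  exact ⟨p, hp, subset_inter (hS.segment_subset hx.1 (hS.segment_subset hx.1 hyS hpxy)) hseg⟩

theorem finite_components_inter {n : ℕ} (Q : Polygon Plane n) {S : Set Plane} (hS : Convex ℝ S) :
    (components (S ∩ region Q)).Finite := by
  refine finite_components (ι := Option (Fin n))
    (E := fun i => i.elim {p | p ∈ S ∧ S ⊆ region Q} fun i => S ∩ Q.edgeSet ℝ i) ?_ ?_ ?_
  · rintro (_ | i)
    · by_cases h : S ⊆ region Q
      · simpa [h] using hS.isPreconnected
      · simpa [h] using isPreconnected_empty
    · rw [Option.elim_some, edgeSet_eq_segment]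
      exact (hS.inter (convex_segment _ _)).isPreconnected
  · rintro (_ | i)
    · exact fun p hp => ⟨hp.1, hp.2 hp.1⟩
    · exact inter_subset_inter_right _ ((subset_iUnion _ i).trans (boundary_subset_region Q))
  · intro x hx
    by_cases h : S ⊆ region Q
    · exact ⟨none, x, ⟨hx.1, h⟩, by simpa using hx⟩
    · obtain ⟨p, hp, hseg⟩ := exists_visible_frontier (isClosed_region Q) hS hx h
      obtain ⟨i, hi⟩ := mem_iUnion.1 (frontier_region_subset Q hp)
      exact ⟨some i, p, ⟨(hseg (right_mem_segment _ _ _)).1, hi⟩, hseg⟩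

/-! ### Nets of directions and positions -/

lemma exists_mem_scaled_net {F : Set Plane} {ε r : ℝ}
    (hF : Metric.closedBall 0 1 ⊆ ⋃ f ∈ F, Metric.ball f ε) (hr : 0 < r) {v : Plane}
    (hv : ‖v‖ ≤ r) : ∃ f ∈ F, ‖v - r • f‖ ≤ ε * r := by
  have h1 : r⁻¹ • v ∈ Metric.closedBall (0 : Plane) 1 := by
    rw [mem_closedBall_zero_iff, norm_smul, norm_inv, Real.norm_of_nonneg hr.le,
      inv_mul_le_iff₀ hr, mul_one]
    exact hv
  obtain ⟨f, hf, hvf⟩ := mem_iUnion₂.1 (hF h1)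
  refine ⟨f, hf, ?_⟩
  rw [mem_ball_iff_norm] at hvf
  have : v - r • f = r • (r⁻¹ • v - f) := by rw [smul_sub, smul_inv_smul₀ hr.ne']
  rw [this, norm_smul, Real.norm_of_nonneg hr.le, mul_comm]
  exact mul_le_mul_of_nonneg_right hvf.le hr.le

theorem exists_partition_of_covered {α β : ℝ} (hα : 0 < α) (hβ : 0 < β) {F : Set Plane} [Fintype F]
    (hF1 : F ⊆ Metric.closedBall 0 1)
    (hF : Metric.closedBall 0 1 ⊆ ⋃ f ∈ F, Metric.ball f (ballRatio α β / 4))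
    {P S : Set Plane} (hPcl : IsClosed P) (hPb : Bornology.IsBounded P) (hP : IsCovered α β P)
    (hS : IsSquare S) (hSP : (S ∩ interior P).Nonempty) :
    ∃ 𝒦 : Partition (components (S ∩ P)), 𝒦.parts.encard ≤ Fintype.card (Option (F × F)) ∧
      ∀ 𝒞 ∈ 𝒦, ∀ C₁ ∈ 𝒞, ∀ C₂ ∈ 𝒞, ∀ x ∈ C₁, ∀ y ∈ C₂,
        gdist P x y ≤ ENNReal.ofReal ((2 * Fintype.card (Option (F × F)) + 1) *
          (2 * Metric.diam S + (2 + ballRatio α β) * Metric.diam S)) := by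
  set c := ballRatio α β with hc
  have hc0 : 0 < c := ballRatio_pos hα hβ
  set D := Metric.diam S
  set d := Metric.diam P
  have hD : 0 < D := hS.diam_pos
  obtain ⟨x₀, hx₀S, hx₀⟩ := hSP
  have hd : 0 < d :=
    Metric.diam_pos (infinite_of_mem_nhds x₀ (mem_interior_iff_mem_nhds.1 hx₀)).nontrivial hPb
  -- Points of `S ∩ P` lie within both diameters of `x₀`. Netting positions at scale `m` makes the
  -- shrinking factor `m / d` at most 1 and the resulting paths `O(D)`.
  set m := min D d
  have hm : 0 < m := lt_min hD hd
  have hl1 : m / d ≤ 1 := (div_le_one hd).2 (min_le_right _ _)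
  have hdist : ∀ x ∈ S ∩ P, ∀ y ∈ S ∩ P, dist x y ≤ D := fun x hx y hy =>
    Metric.dist_le_diam_of_mem hS.isCompact.isBounded hx.1 hy.1
  -- The index `none` covers the case `S ⊆ P`. Rounding the direction costs `c * d / 4` of the
  -- radius `c * d`, so radius `c * d / 2` is safe; position balls of radius `c * m / 4` give `dist
  -- p q ≤ (m / d) * (c * d / 2)`.
  refine exists_partition_components (A := fun i => i.elim {_p | S ⊆ P} fun z =>
      seesBall P (d • z.1.1) (c * d / 2) ∩ Metric.closedBall (x₀ + m • z.2.1) (c * m / 4))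
    ⟨x₀, hx₀S, interior_subset hx₀⟩ (hS.isCompact.inter_right hPcl) inter_subset_right
    ?_ hD.le (by positivity) hdist ?_ ?_
  · rintro (_ | z)
    · exact isClosed_const
    · exact (isClosed_seesBall hPcl _ _).inter Metric.isClosed_closedBall
  · rintro (_ | ⟨⟨v, hv⟩, ⟨f, hf⟩⟩) p ⟨hp, hpX⟩ q ⟨hq, hqX⟩
    · have hSP : S ⊆ P := hp
      refine (gdist_le_of_segment ((hS.convex.segment_subset hpX.1 hqX.1).trans hSP)).trans
        (ENNReal.ofReal_le_ofReal ?_)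
      nlinarith [hdist p hpX q hqX]
    · have hpq : dist p q ≤ m / d * (c * d / 2) := by
        have h1 := Metric.mem_closedBall.1 hp.2
        have h2 := Metric.mem_closedBall'.1 hq.2
        have h3 := dist_triangle p (x₀ + m • f) q
        have h4 : m / d * (c * d / 2) = c * m / 4 + c * m / 4 := by field_simp; ring
        simp only at h1 h2
        linarith
      refine (gdist_le_of_seesBall hp.1 hq.1 (by positivity) (by positivity) hl1 hpq).trans
        (ENNReal.ofReal_le_ofReal ?_)
      have hv1 : ‖v‖ ≤ 1 := by simpa using hF1 hv
      simp only [norm_smul, Real.norm_of_nonneg hd.le]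
      calc m / d * (2 * (d * ‖v‖) + c * d / 2) = m * (2 * ‖v‖ + c / 2) := by field_simp
        _ ≤ D * (2 + c) := by
          apply mul_le_mul (min_le_left _ _) (by linarith) (by positivity) hD.le
        _ = _ := mul_comm _ _
  · intro x hx
    by_cases h : S ⊆ P
    · exact ⟨none, x, h, by simpa using hx⟩
    obtain ⟨p, hp, hseg⟩ := exists_visible_frontier hPcl hS.convex hx h
    have hpX := hseg (right_mem_segment _ _ _)
    obtain ⟨v, hv, hpv⟩ := hP.exists_mem_seesBall hα hβ hPb hd hp
    obtain ⟨w, hw, hvw⟩ := exists_mem_scaled_net hF hd hv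
    have hpm : ‖p - x₀‖ ≤ m := by
      rw [← dist_eq_norm]
      exact le_min (hdist p hpX x₀ ⟨hx₀S, interior_subset hx₀⟩)
        (Metric.dist_le_diam_of_mem hPb hpX.2 (interior_subset hx₀))
    obtain ⟨f, hf, hpf⟩ := exists_mem_scaled_net hF hm hpm
    refine ⟨some (⟨w, hw⟩, ⟨f, hf⟩), p, ⟨seesBall_mono ?_ hpv, ?_⟩, hseg⟩
    · apply Metric.closedBall_subset_closedBall'
      rw [dist_eq_norm, norm_sub_rev]
      have : 0 < c * d := by positivity
      simp only
      linarith
    · rw [mem_closedBall_iff_norm, ← sub_sub]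
      simp only
      linarith

end SquarePartition
end

theorem mainTheorem4 (α β : ℝ) (hα : 0 < α) (hβ : 0 < β) :
    ∃ (t : ℕ) (M : ℝ), 0 < M ∧
      ∀ P S : Set SquarePartition.Plane,
        SquarePartition.IsSimplePolygon P →
        SquarePartition.IsCovered α β P →
        SquarePartition.IsSquare S →
        (S ∩ interior P).Nonempty →
        (SquarePartition.components (S ∩ P)).Finite ∧
        ∃ 𝒦 : Partition (SquarePartition.components (S ∩ P)),
          𝒦.parts.encard ≤ t ∧
          ∀ 𝒞 ∈ 𝒦, ∀ C₁ ∈ 𝒞, ∀ C₂ ∈ 𝒞, ∀ x ∈ C₁, ∀ y ∈ C₂,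
            SquarePartition.gdist P x y ≤ ENNReal.ofReal (M * Metric.diam S) := by
  have hc := SquarePartition.ballRatio_pos hα hβ
  obtain ⟨F, hF1, hFfin, hF⟩ := (isCompact_closedBall (0 : SquarePartition.Plane) 1
    ).finite_cover_balls (div_pos hc four_pos)
  have := hFfin.fintype
  refine ⟨Fintype.card (Option (F × F)), (2 * Fintype.card (Option (F × F)) + 1) *
    (2 + (2 + SquarePartition.ballRatio α β)), by positivity, ?_⟩
  rintro _ S ⟨n, Q, -, rfl⟩ hP hS hSP
  refine ⟨SquarePartition.finite_components_inter Q hS.convex, ?_⟩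
  obtain ⟨𝒦, hcard, hdist⟩ := SquarePartition.exists_partition_of_covered hα hβ hF1 hF
    (SquarePartition.isClosed_region Q) (SquarePartition.isBounded_region Q) hP hS hSP
  refine ⟨𝒦, hcard, fun 𝒞 h𝒞 C₁ h₁ C₂ h₂ x hx y hy =>
    (hdist 𝒞 h𝒞 C₁ h₁ C₂ h₂ x hx y hy).trans_eq ?_⟩
  congr 1
  ring
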